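/- Let $\alpha$ be an action of a discrete group $G$ by homeomorphisms on a locally compact Hausdorff space $X$, and let $\mathcal F$ be a nonempty family of subgroups of $G$ that is closed under conjugation and under taking subgroups. Then $$\dim_{\mathrm{LTC}}(\alpha)+1\;\le\;\bigl(\operatorname{eqasdim}(\alpha,\mathcal F)+1\bigr)\cdot\sup_{H\in\mathcal F}\bigl(\dim_{\mathrm{LTC}}(\alpha|_H)+1\bigr),$$ where $\alpha|_H$ is the restricted action of $H$ on $X$, all quantities take values in $\{0,1,2,\dots,\infty\}$, an infimum over the empty set is $\infty$, and the multiplicity $\operatorname{mult}(\mathcal U)$ of a collection $\mathcal U$ of subsets of a set is the supremum over the points of the number of members of $\mathcal U$ containing the point. Here $\dim_{\mathrm{LTC}}(\alpha)$, the long thin covering dimension, is the infimum of all integers $d\ge 0$ such that for every finite $L\subseteq G$ and compact $K\subseteq X$ there is a natural number $M$ such that for every finite collection $\mathcal V$ of open subsets of $X$ covering $\bigcup_{g\in L}\alpha_g(K)$ there are a collection $\mathcal U$ of open subsets of $X$ and locally constant functions $\Lambda_U\colon U\to X$, $U\in\mathcal U$, with: (long) for every $x\in K$ there is $U\in\mathcal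 U$ with $\alpha_g(x)\in U$ for all $g\in L$; (multiplicity) $\operatorname{mult}(\mathcal U)\le d+1$; (equivariance) $\Lambda_U(\alpha_g(x))=\alpha_g(\Lambda_U(x))$ whenever $U\in\mathcal U$, $g\in L$ and $x,\alpha_g(x)\in U$; (thin) for every $U\in\mathcal U$ and $y\in\Lambda_U(U)$ there is $V\in\mathcal V$ with $\Lambda_U^{-1}(y)\cup\{y\}\subseteq V$; (cardinality) $|\Lambda_U(U)|\le M$ for every $U\in\mathcal U$. Further, $\operatorname{eqasdim}(\alpha,\mathcal F)$, the equivariant asymptotic dimension of $\alpha$ relative to $\mathcal F$, is the infimum of all integers $d\ge 0$ such that for every finite $L\subseteq G$ and compact $K\subseteq X$ there is a collection $\mathcal W$ of open subsets of $G\times X$ with: for every $x\in K$ there is $W\in\mathcal W$ with $L\times\{x\}\subseteq W$; $\operatorname{mult}(\mathcal W)\le d+1$; for the action $\Delta_g(g',x)=(g'g^{-1},\alpha_g(x))$ of $G$ on $G\times X$, and all $W\in\mathcal W$ and $g\in G$, the set $\Delta_g(W)$ belongs to $\mathcal W$ and is equal to $W$ or disjoint from $W$; and $\{g\in G:\Delta_g(W)=W\}\in\mathcal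 F$ for every $W\in\mathcal W$. -/

import Mathlib

namespace LongThin

/-- The multiplicity of a collection `𝒰` of subsets of `Y`: the supremum over the points `y`
of the number of members of `𝒰` that contain `y`. -/
noncomputable def mult {Y : Type*} (𝒰 : Set (Set Y)) : ℕ∞ :=
  ⨆ y : Y, {U : Set Y | U ∈ 𝒰 ∧ y ∈ U}.encard

section LTC

variable (G X : Type*) [Group G] [TopologicalSpace X] [MulAction G X]

/-- A collection `𝒰` of subsets of `X`, with near orbit selection functions `Λ U : U → X` for
`U ∈ 𝒰`, is a long thin cover for the parameters `d` (dimension), `L` (length), `K` (compact set),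
`M` (cardinality) and `𝒱` (thinness). The values of `Λ` outside `𝒰` play no role. -/
structure IsLongThinCover (d : ℕ) (L : Finset G) (K : Set X) (M : ℕ) (𝒱 : Set (Set X))
    (𝒰 : Set (Set X)) (Λ : ∀ U : Set X, U → X) : Prop where
  isOpen : ∀ U ∈ 𝒰, IsOpen U
  locConst : ∀ U ∈ 𝒰, IsLocallyConstant (Λ U)
  /-- long: each point of `K` has its whole `L`-orbit piece in one member -/
  long : ∀ x ∈ K, ∃ U ∈ 𝒰, ∀ g ∈ L, g • x ∈ U
  /-- multiplicity -/
  mult_le : mult 𝒰 ≤ d + 1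
  /-- equivariance: each `Λ U` is `L`-equivariant -/
  equivariant : ∀ U ∈ 𝒰, ∀ g ∈ L, ∀ (x : X) (hx : x ∈ U) (hgx : g • x ∈ U),
    Λ U ⟨g • x, hgx⟩ = g • Λ U ⟨x, hx⟩
  /-- thin: each fiber of `Λ U`, together with the value, lies in a member of `𝒱` -/
  thin : ∀ U ∈ 𝒰, ∀ y ∈ Set.range (Λ U), ∃ V ∈ 𝒱, (Subtype.val '' (Λ U ⁻¹' {y})) ∪ {y} ⊆ V
  /-- cardinality: the range of each `Λ U` has at most `M` points -/
  card_le : ∀ U ∈ 𝒰, (Set.range (Λ U)).encard ≤ M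

/-- The bound `d` for the long thin covering dimension. The number `M` may depend on `L` and `K`,
but not on `𝒱`. -/
def LTCDimLE (d : ℕ) : Prop :=
  ∀ (L : Finset G) (K : Set X), IsCompact K → ∃ M : ℕ,
    ∀ 𝒱 : Set (Set X), 𝒱.Finite → (∀ V ∈ 𝒱, IsOpen V) →
      (∀ g ∈ L, ∀ x ∈ K, g • x ∈ ⋃₀ 𝒱) →
      ∃ (𝒰 : Set (Set X)) (Λ : ∀ U : Set X, U → X), IsLongThinCover G X d L K M 𝒱 𝒰 Λ

/-- The long thin covering dimension of an action of a discrete group `G` on a locally compact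
Hausdorff space `X`: the infimum (`⊤` if there is none) of the natural numbers `d`
that bound it. -/
noncomputable def dimLTC : ℕ∞ := ⨅ (d : ℕ) (_ : LTCDimLE G X d), (d : ℕ∞)

end LTC

section EqAsdim

variable (G X : Type*) [Group G] [MulAction G X]

/-- The diagonal action of `G` on `G × X`: `Δ_g (g', x) = (g' g⁻¹, g x)`. -/
def diag (g : G) (p : G × X) : G × X := (p.1 * g⁻¹, g • p.2)

/-- The diagonal action on the subsets of `G × X`. -/
def diagSet (g : G) (W : Set (G × X)) : Set (G × X) := diag G X g '' W

theorem diagSet_one (W : Set (G × X)) : diagSet G X 1 W = W := by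
  have h : diag G X 1 = id := by funext p; simp [diag]
  simp [diagSet, h]

theorem diagSet_mul (g h : G) (W : Set (G × X)) :
    diagSet G X (g * h) W = diagSet G X g (diagSet G X h W) := by
  have e : diag G X (g * h) = diag G X g ∘ diag G X h := by
    funext p; simp [diag, mul_smul, mul_assoc]
  simp only [diagSet, e, Set.image_comp]

/-- The set stabilizer of `W ⊆ G × X` for the diagonal action. -/
def setStab (W : Set (G × X)) : Subgroup G where
  carrier := {g | diagSet G X g W = W}
  one_mem' := diagSet_one G X W
  mul_mem' {a b} ha hb := by
    change diagSet G X (a * b) W = W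
    change diagSet G X a W = W at ha
    change diagSet G X b W = W at hb
    rw [diagSet_mul, hb, ha]
  inv_mem' {a} ha := by
    change diagSet G X a⁻¹ W = W
    change diagSet G X a W = W at ha
    conv_lhs => rw [← ha]
    rw [← diagSet_mul, inv_mul_cancel, diagSet_one]

variable [TopologicalSpace G] [TopologicalSpace X]

/-- The bound `d` for the equivariant asymptotic dimension relative to `F`. -/
def EqAsdimLE (F : Set (Subgroup G)) (d : ℕ) : Prop :=
  ∀ (L : Finset G) (K : Set X), IsCompact K → ∃ 𝒲 : Set (Set (G × X)),
    (∀ W ∈ 𝒲, IsOpen W) ∧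
    (∀ x ∈ K, ∃ W ∈ 𝒲, ∀ g ∈ L, (g, x) ∈ W) ∧
    mult 𝒲 ≤ d + 1 ∧
    (∀ W ∈ 𝒲, ∀ g : G, diagSet G X g W ∈ 𝒲 ∧
      (diagSet G X g W = W ∨ Disjoint (diagSet G X g W) W)) ∧
    (∀ W ∈ 𝒲, setStab G X W ∈ F)

/-- The equivariant asymptotic dimension, relative to a family `F` of subgroups, of an action of a
discrete group `G` on a locally compact Hausdorff space `X`: the infimum (`⊤` if there is
none) of the natural numbers `d` that bound it. -/
noncomputable def eqasdim (F : Set (Subgroup G)) : ℕ∞ :=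
  ⨅ (d : ℕ) (_ : EqAsdimLE G X F d), (d : ℕ∞)

end EqAsdim

end LongThin

namespace LongThin

open Set Topology

/-! Long thin covers are induced from the stabilizers `H ∈ F` up to `G`. By compactness, finitely
many members of a cover `𝒲` of `G × X` serve `K`; choose representatives of their diagonal orbits.
For a representative `W` with stabilizer `H`, the elements `g` with `(g, g⁻¹ • z) ∈ W` lie in a
single coset of `H`, so `z` acquires at most one label `s` among coset representatives. A long thin
cover for `H` is pulled back along `z ↦ s⁻¹ • z`, and its selections `f` become `z ↦ s • f (s⁻¹ •
z)` (`exists_isSelection_labelPullback`, `LTCDimLE.exists_selections`).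

At most `d + 1` representatives label a given point and each contributes at most `e + 1` sets,
whence the product (`EqAsdimLE.ltcDimLE`). The labels form a finite set depending only on `L` and
`K`, so the cardinality bound is independent of `𝒱`; thinness survives the translations by
`exists_star_refinement`. -/

/-! ### Star refinement by uniformities -/

/-- A finite open cover of a compact set `P` that is so fine that the translates, by elements of a
finite set `T`, of its members star-refine the open cover `𝒱` of the compact set `Q`. -/
theorem exists_star_refinement {G X : Type*} [Group G] [TopologicalSpace X]
    [CompletelyRegularSpace X] [MulAction G X] [ContinuousConstSMul G X]
    {Q P : Set X} (hQ : IsCompact Q) (hP : IsCompact P) {𝒱 : Set (Set X)}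
    (hopen : ∀ V ∈ 𝒱, IsOpen V) (hcov : Q ⊆ ⋃₀ 𝒱) {T : Set G} (hT : T.Finite) :
    ∃ (N : Set X) (𝒱' : Set (Set X)), IsOpen N ∧ Q ⊆ N ∧ 𝒱'.Finite ∧ (∀ V ∈ 𝒱', IsOpen V) ∧
      P ⊆ ⋃₀ 𝒱' ∧ ∀ (y : X) (S : Set X), (S ∩ N).Nonempty →
        (∀ z ∈ S, ∃ t ∈ T, ∃ V ∈ 𝒱', t⁻¹ • z ∈ V ∧ t⁻¹ • y ∈ V) → ∃ V ∈ 𝒱, S ∪ {y} ⊆ V := by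
  obtain ⟨u, rfl⟩ := CompletelyRegularSpace.exists_uniformSpace (X := X)
  -- Lebesgue entourages exist only at points `q ∈ Q`, so `S` must meet `N`: then `q` is `E₁`-close
  -- to some `z₀ ∈ S`, which is `E₁`-close to `y`, and the rest of `S` is `E₁`-close to `y`.
  obtain ⟨E, hE, hEV⟩ := lebesgue_number_lemma_sUnion hQ hopen hcov
  obtain ⟨E₂, hE₂, hE₂E⟩ := comp_mem_uniformity_sets hE
  obtain ⟨E₁, hE₁, hs₁, hE₁E⟩ := comp_comp_symm_mem_uniformity_sets hE₂
  have hsmall : ∀ p : X, ∃ V : Set X, IsOpen V ∧ p ∈ V ∧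
      ∀ t ∈ T, ∀ a, t⁻¹ • a ∈ V → ∀ b, t⁻¹ • b ∈ V → (a, b) ∈ E₁ := by
    intro p
    obtain ⟨E₀, hE₀, hs₀, hE₀E⟩ := comp_symm_mem_uniformity_sets hE₁
    have h1 : ∀ᶠ q in 𝓝 p, ∀ t ∈ T, (t • p, t • q) ∈ E₀ := by
      rw [Filter.eventually_all_finite hT]
      intro t _
      exact (continuous_const_smul t).continuousAt (UniformSpace.ball_mem_nhds (t • p) hE₀)
    obtain ⟨V, hV, hVo, hpV⟩ := eventually_nhds_iff.1 h1
    refine ⟨V, hVo, hpV, fun t ht a ha b hb => hE₀E ⟨t • p, ?_, ?_⟩⟩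
    · have := hV _ ha t ht
      rw [smul_inv_smul] at this
      exact hs₀.symm _ _ this
    · have := hV _ hb t ht
      rwa [smul_inv_smul] at this
  choose V hVo hVm hVE using hsmall
  obtain ⟨F, -, hF⟩ := hP.elim_nhds_subcover V fun p _ => (hVo p).mem_nhds (hVm p)
  refine ⟨⋃ q ∈ Q, interior (UniformSpace.ball q E₁), V '' F,
    isOpen_biUnion fun _ _ => isOpen_interior, fun q hq => ?_, F.finite_toSet.image V, ?_, ?_, ?_⟩
  · exact mem_biUnion hq (mem_interior_iff_mem_nhds.2 (UniformSpace.ball_mem_nhds q hE₁))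
  · rintro _ ⟨p, -, rfl⟩
    exact hVo p
  · intro x hx
    obtain ⟨p, hp, hxp⟩ := mem_iUnion₂.1 (hF hx)
    exact ⟨V p, ⟨p, hp, rfl⟩, hxp⟩
  · rintro y S ⟨z₀, hz₀, hN⟩ hS
    have key : ∀ z ∈ S, (y, z) ∈ E₁ := by
      intro z hz
      obtain ⟨t, ht, _, ⟨p, -, rfl⟩, h1, h2⟩ := hS z hz
      exact hVE p t ht _ h2 _ h1
    obtain ⟨q, hq, hqz⟩ := mem_iUnion₂.1 hN
    have hqz : (q, z₀) ∈ E₁ := interior_subset (s := UniformSpace.ball q E₁) hqz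
    have hqy : (q, y) ∈ E₂ :=
      hE₁E ⟨y, ⟨z₀, hqz, hs₁.symm _ _ (key _ hz₀)⟩, refl_mem_uniformity hE₁⟩
    obtain ⟨V₀, hV₀, hqV⟩ := hEV q hq
    refine ⟨V₀, hV₀, ?_⟩
    rintro z (hz | rfl)
    · refine hqV (hE₂E ⟨y, hqy, ?_⟩)
      exact hE₁E ⟨z, ⟨z, key z hz, refl_mem_uniformity hE₁⟩, refl_mem_uniformity hE₁⟩
    · exact hqV (hE₂E ⟨z, hqy, refl_mem_uniformity hE₂⟩)

/-! ### Selections and their pullback along labels -/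

/-- A near orbit selection function on a single set `U`, for the parameters `L`, `M` and `𝒱`. -/
structure IsSelection {G X : Type*} [Group G] [TopologicalSpace X] [MulAction G X]
    (L : Finset G) (M : ℕ) (𝒱 : Set (Set X)) (U : Set X) (f : U → X) : Prop where
  locConst : IsLocallyConstant f
  equivariant : ∀ g ∈ L, ∀ (x : X) (hx : x ∈ U) (hgx : g • x ∈ U),
    f ⟨g • x, hgx⟩ = g • f ⟨x, hx⟩
  thin : ∀ y ∈ range f, ∃ V ∈ 𝒱, (Subtype.val '' (f ⁻¹' {y})) ∪ {y} ⊆ V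
  card_le : (range f).encard ≤ M

theorem IsLongThinCover.isSelection {G X : Type*} [Group G] [TopologicalSpace X] [MulAction G X]
    {d : ℕ} {L : Finset G} {K : Set X} {M : ℕ} {𝒱 𝒰 : Set (Set X)} {f : ∀ U : Set X, U → X}
    (h : IsLongThinCover G X d L K M 𝒱 𝒰 f) {U : Set X} (hU : U ∈ 𝒰) :
    IsSelection L M 𝒱 U (f U) :=
  ⟨h.locConst U hU, h.equivariant U hU, h.thin U hU, h.card_le U hU⟩

theorem IsSelection.mono {G X : Type*} [Group G] [TopologicalSpace X] [MulAction G X]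
    {L : Finset G} {M M' : ℕ} {𝒱 : Set (Set X)} {U : Set X} {f : U → X}
    (h : IsSelection L M 𝒱 U f) (hM : M ≤ M') : IsSelection L M' 𝒱 U f :=
  ⟨h.locConst, h.equivariant, h.thin, h.card_le.trans (by exact_mod_cast hM)⟩

theorem exists_isLongThinCover {G X : Type*} [Group G] [TopologicalSpace X] [MulAction G X]
    {d : ℕ} {L : Finset G} {K : Set X} {M : ℕ} {𝒱 𝒰 : Set (Set X)}
    (hopen : ∀ U ∈ 𝒰, IsOpen U) (hlong : ∀ x ∈ K, ∃ U ∈ 𝒰, ∀ g ∈ L, g • x ∈ U)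
    (hmult : mult 𝒰 ≤ d + 1) (hsel : ∀ U ∈ 𝒰, ∃ f : U → X, IsSelection L M 𝒱 U f) :
    ∃ f : ∀ U : Set X, U → X, IsLongThinCover G X d L K M 𝒱 𝒰 f := by
  have : ∀ U : Set X, ∃ f : U → X, U ∈ 𝒰 → IsSelection L M 𝒱 U f := by
    intro U
    by_cases hU : U ∈ 𝒰
    · obtain ⟨f, hf⟩ := hsel U hU
      exact ⟨f, fun _ => hf⟩
    · exact ⟨Subtype.val, fun h => absurd h hU⟩
  choose f hf using this
  exact ⟨f, hopen, fun U hU => (hf U hU).locConst, hlong, hmult,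
    fun U hU => (hf U hU).equivariant, fun U hU => (hf U hU).thin, fun U hU => (hf U hU).card_le⟩

/-- The set of the points of `N` whose translate by the inverse of their label in `T` lies
in `U`, where `D t` is the set of the points with label `t`. -/
def labelPullback {G X : Type*} [Group G] [MulAction G X] (T : Set G) (D : G → Set X)
    (N U : Set X) : Set X :=
  {z | z ∈ N ∧ ∃ t ∈ T, z ∈ D t ∧ t⁻¹ • z ∈ U}

theorem isOpen_labelPullback {G X : Type*} [Group G] [TopologicalSpace X] [MulAction G X]
    [ContinuousConstSMul G X] {T : Set G} {D : G → Set X} (hD : ∀ t ∈ T, IsOpen (D t))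
    {N U : Set X} (hN : IsOpen N) (hU : IsOpen U) : IsOpen (labelPullback T D N U) := by
  have : labelPullback T D N U = N ∩ ⋃ t ∈ T, D t ∩ (fun z => t⁻¹ • z) ⁻¹' U := by
    ext z; simp [labelPullback, and_left_comm]
  rw [this]
  exact hN.inter (isOpen_biUnion fun t ht =>
    (hD t ht).inter (hU.preimage (continuous_const_smul _)))

/-- Labels are locally constant because the sets `D t` are open and disjoint. Passing from `z` to `l
• z` moves the unlabelled point by `t'⁻¹ * l * t ∈ H`, so equivariance under `LH` yields
equivariance under `L`. A fiber may mix labels, which is why a star refinement is needed and why the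
bound gains the factor `|T|`. -/
theorem exists_isSelection_labelPullback {G X : Type*} [Group G] [TopologicalSpace X]
    [MulAction G X] [ContinuousConstSMul G X] {H : Subgroup G} {L : Finset G} {LH : Finset H}
    {T : Set G} (hT : T.Finite) {D : G → Set X} (hD : ∀ t ∈ T, IsOpen (D t))
    (hdisj : ∀ t ∈ T, ∀ t' ∈ T, ∀ z, z ∈ D t → z ∈ D t' → t = t')
    (htrans : ∀ t ∈ T, ∀ t' ∈ T, ∀ l ∈ L, ∀ z, z ∈ D t → l • z ∈ D t' →
      ∃ h ∈ LH, (h : G) = t'⁻¹ * l * t)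
    {N : Set X} {𝒱 𝒱' : Set (Set X)}
    (hstar : ∀ (y : X) (S : Set X), (S ∩ N).Nonempty →
      (∀ z ∈ S, ∃ t ∈ T, ∃ V ∈ 𝒱', t⁻¹ • z ∈ V ∧ t⁻¹ • y ∈ V) → ∃ V ∈ 𝒱, S ∪ {y} ⊆ V)
    {U : Set X} {M : ℕ} {f : U → X} (hf : IsSelection LH M 𝒱' U f) :
    ∃ f' : labelPullback T D N U → X,
      IsSelection L (hT.toFinset.card * M) 𝒱 (labelPullback T D N U) f' := by
  choose τ hτT hτD hτU using fun z : labelPullback T D N U => z.2.2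
  have huniq : ∀ z : labelPullback T D N U, ∀ t ∈ T, (z : X) ∈ D t → τ z = t :=
    fun z t ht hz => hdisj _ (hτT z) _ ht _ (hτD z) hz
  have hval : ∀ z : labelPullback T D N U, ∀ t ∈ T, (z : X) ∈ D t → ∀ h : t⁻¹ • (z : X) ∈ U,
      τ z • f ⟨_, hτU z⟩ = t • f ⟨_, h⟩ := by
    intro z t ht hz h
    obtain rfl := huniq z t ht hz
    rfl
  refine ⟨fun z => τ z • f ⟨_, hτU z⟩, ?_, ?_, ?_, ?_⟩
  · rw [IsLocallyConstant.iff_eventually_eq]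
    intro z
    have h1 : ∀ᶠ w : labelPullback T D N U in 𝓝 z, (w : X) ∈ D (τ z) :=
      continuous_subtype_val.continuousAt ((hD _ (hτT z)).mem_nhds (hτD z))
    have h2 : ∀ᶠ w in 𝓝 ((τ z)⁻¹ • (z : X)), ∀ hw : w ∈ U, f ⟨w, hw⟩ = f ⟨_, hτU z⟩ := by
      have := (IsLocallyConstant.iff_eventually_eq f).1 hf.locConst ⟨_, hτU z⟩
      rw [nhds_subtype_eq_comap, Filter.eventually_comap] at this
      exact this.mono fun w hw hwU => hw ⟨w, hwU⟩ rfl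
    have h3 : ∀ᶠ w : labelPullback T D N U in 𝓝 z, ∀ hw : (τ z)⁻¹ • (w : X) ∈ U,
        f ⟨_, hw⟩ = f ⟨_, hτU z⟩ :=
      ((continuous_const_smul (τ z)⁻¹).comp continuous_subtype_val).continuousAt.eventually h2
    filter_upwards [h1, h3] with w hw1 hw2
    have hw : (τ z)⁻¹ • (w : X) ∈ U := by
      rw [← huniq w _ (hτT z) hw1]
      exact hτU w
    change τ w • f ⟨_, hτU w⟩ = τ z • f ⟨_, hτU z⟩
    rw [hval w _ (hτT z) hw1 hw, hw2 hw]
  · intro l hl x hx hlx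
    obtain ⟨h, hh, hh'⟩ := htrans _ (hτT ⟨x, hx⟩) _ (hτT ⟨l • x, hlx⟩) l hl x
      (hτD ⟨x, hx⟩) (hτD ⟨l • x, hlx⟩)
    have e : (τ ⟨l • x, hlx⟩)⁻¹ • (l • x) = h • ((τ ⟨x, hx⟩)⁻¹ • x) := by
      rw [Subgroup.smul_def, hh']
      simp [mul_smul]
    have hU : h • ((τ ⟨x, hx⟩)⁻¹ • x) ∈ U := e ▸ hτU ⟨l • x, hlx⟩
    have e2 : f ⟨_, hτU ⟨l • x, hlx⟩⟩ = h • f ⟨_, hτU ⟨x, hx⟩⟩ := by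
      rw [← hf.equivariant h hh _ (hτU ⟨x, hx⟩) hU]
      congr 1
      exact Subtype.ext e
    change τ _ • f _ = l • τ _ • f _
    rw [e2, Subgroup.smul_def, hh']
    simp [mul_smul]
  · rintro _ ⟨z₀, rfl⟩
    refine hstar _ _ ⟨z₀, ⟨z₀, rfl, rfl⟩, z₀.2.1⟩ ?_
    rintro _ ⟨z, hz, rfl⟩
    obtain ⟨V, hV, hVs⟩ := hf.thin _ ⟨⟨_, hτU z⟩, rfl⟩
    refine ⟨τ z, hτT z, V, hV, hVs (Or.inl ⟨⟨_, hτU z⟩, rfl, rfl⟩), hVs (Or.inr ?_)⟩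
    have hz : τ z • f ⟨_, hτU z⟩ = τ z₀ • f ⟨_, hτU z₀⟩ := hz
    change (τ z)⁻¹ • (τ z₀ • f _) = f _
    rw [← hz, inv_smul_smul]
  · have hsub : (range fun z => τ z • f ⟨_, hτU z⟩) ⊆
        ⋃ t ∈ T, (fun y => t • y) '' range f := by
      rintro _ ⟨z, rfl⟩
      exact mem_biUnion (hτT z) ⟨_, ⟨_, rfl⟩, rfl⟩
    refine (encard_le_encard hsub).trans ?_
    have := hT.toFinset.set_encard_biUnion_le fun t => (fun y => t • y) '' range f
    simp only [Finite.mem_toFinset] at this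
    refine this.trans ((Finset.sum_le_card_nsmul _ _ (M : ℕ∞) fun t _ =>
      (encard_image_le _ _).trans hf.card_le).trans ?_)
    simp

/-- A point has at most one label `t`, so only members of `𝒰` containing `t⁻¹ • z` matter. -/
theorem encard_labelPullback_le {G X : Type*} [Group G] [MulAction G X]
    {T : Set G} {D : G → Set X}
    (hdisj : ∀ t ∈ T, ∀ t' ∈ T, ∀ z, z ∈ D t → z ∈ D t' → t = t')
    (N : Set X) {𝒰 : Set (Set X)} {n : ℕ∞} (h : mult 𝒰 ≤ n) (z : X) :
    {U | U ∈ labelPullback T D N '' 𝒰 ∧ z ∈ U}.encard ≤ n := by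
  by_cases hz : ∃ t ∈ T, z ∈ D t
  · obtain ⟨t, ht, hzt⟩ := hz
    refine le_trans ?_ ((encard_image_le (labelPullback T D N) _).trans
      ((le_iSup _ (t⁻¹ • z)).trans h))
    refine encard_le_encard ?_
    rintro _ ⟨⟨U, hU, rfl⟩, hzN, t', ht', hzt', hzU⟩
    obtain rfl := hdisj t ht t' ht' z hzt hzt'
    exact ⟨U, ⟨hU, hzU⟩, rfl⟩
  · have : {U | U ∈ labelPullback T D N '' 𝒰 ∧ z ∈ U} = ∅ := by
      refine eq_empty_of_forall_notMem ?_
      rintro _ ⟨⟨U, hU, rfl⟩, hzN, t, ht, hzt, -⟩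
      exact hz ⟨t, ht, hzt⟩
    rw [this, encard_empty]
    exact zero_le


/-! ### Induction from one stabilizer -/

open scoped Pointwise in
open scoped Classical in
/-- The contribution of a single open set `W` of `G × X` whose translates by the diagonal action
meet `W` only for elements of the subgroup `H`, which leaves `W` invariant. -/
theorem LTCDimLE.exists_selections {G X : Type*} [Group G] [TopologicalSpace G]
    [DiscreteTopology G] [TopologicalSpace X] [CompletelyRegularSpace X] [MulAction G X]
    [ContinuousConstSMul G X] {H : Subgroup G} {e : ℕ} (hH : LTCDimLE H X e)
    {W : Set (G × X)} (hW : IsOpen W) (hinv : ∀ h ∈ H, ∀ p ∈ W, diag G X h p ∈ W)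
    (hsep : ∀ g : G, ∀ p ∈ W, diag G X g p ∈ W → g ∈ H)
    (L Γ : Finset G) {K : Set X} (hK : IsCompact K) :
    ∃ M : ℕ, ∀ 𝒱 : Set (Set X), (∀ V ∈ 𝒱, IsOpen V) → (∀ g ∈ L, ∀ x ∈ K, g • x ∈ ⋃₀ 𝒱) →
      ∃ 𝒰 : Set (Set X), (∀ U ∈ 𝒰, IsOpen U) ∧ (∀ U ∈ 𝒰, ∃ f : U → X, IsSelection L M 𝒱 U f) ∧
        (∀ z, {U | U ∈ 𝒰 ∧ z ∈ U}.encard ≤ e + 1) ∧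
        (∀ U ∈ 𝒰, ∀ z ∈ U, ∃ g : G, (g, g⁻¹ • z) ∈ W) ∧
        ∀ γ ∈ Γ, ∀ x ∈ K, (∀ l ∈ insert 1 L * L, (l * γ, γ⁻¹ • x) ∈ W) →
          ∃ U ∈ 𝒰, ∀ l ∈ L, l • x ∈ U := by
  set t : G → G := fun g => Quotient.out (g : G ⧸ H) with ht
  have ht_mk : ∀ g, ((t g : G) : G ⧸ H) = g := fun g => Quotient.out_eq _
  set T : Finset G := (L * Γ).image t with hTdef
  -- Asking for all `l * s`, not just `s`, forces the label of `l • z`, if any, into the coset of `l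
  -- * s`.
  set D : G → Set X := fun s => {z | ∀ l ∈ insert 1 L, (l * s, s⁻¹ • z) ∈ W} with hDdef
  have hDW : ∀ s z, z ∈ D s → (s, s⁻¹ • z) ∈ W := fun s z hz => by
    simpa using hz 1 (Finset.mem_insert_self _ _)
  have hcoset : ∀ s s' z, (s, s⁻¹ • z) ∈ W → (s', s'⁻¹ • z) ∈ W → s'⁻¹ * s ∈ H := by
    intro s s' z h h'
    refine hsep _ _ h ?_
    simpa [diag, mul_smul] using h'
  have hDo : ∀ s ∈ (T : Set G), IsOpen (D s) := by
    intro s _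
    have : D s = ⋂ l ∈ insert 1 L, (fun z => (l * s, s⁻¹ • z)) ⁻¹' W := by
      ext z; simp [hDdef]
    rw [this]
    exact isOpen_biInter_finset fun l _ =>
      hW.preimage (continuous_const.prodMk (continuous_const_smul _))
  have hdisj : ∀ s ∈ (T : Set G), ∀ s' ∈ (T : Set G), ∀ z, z ∈ D s → z ∈ D s' → s = s' := by
    intro s hs s' hs' z hz hz'
    obtain ⟨g, -, rfl⟩ := Finset.mem_image.1 (Finset.mem_coe.1 hs)
    obtain ⟨g', -, rfl⟩ := Finset.mem_image.1 (Finset.mem_coe.1 hs')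
    have h1 := QuotientGroup.eq.2 (hcoset _ _ z (hDW _ _ hz) (hDW _ _ hz'))
    rw [ht_mk, ht_mk] at h1
    simp only [ht, h1]
  -- The first part compares labels of `z` and `l • z`; the second carries `γ⁻¹ • x` to the
  -- unlabelled form of `l • x`, for longness.
  set LH : Finset H :=
    (T⁻¹ * L * T ∪ T⁻¹ * (L * Γ)).preimage Subtype.val Subtype.val_injective.injOn with hLH
  have htrans : ∀ s ∈ (T : Set G), ∀ s' ∈ (T : Set G), ∀ l ∈ L, ∀ z, z ∈ D s → l • z ∈ D s' →
      ∃ h ∈ LH, (h : G) = s'⁻¹ * l * s := by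
    intro s hs s' hs' l hl z hz hlz
    have h1 : s'⁻¹ * (l * s) ∈ H := by
      refine hcoset (l * s) s' (l • z) ?_ (hDW _ _ hlz)
      have := hz l (Finset.mem_insert_of_mem hl)
      simpa [mul_smul] using this
    rw [← mul_assoc] at h1
    refine ⟨⟨_, h1⟩, ?_, rfl⟩
    rw [hLH, Finset.mem_preimage]
    exact Finset.mem_union_left _ (Finset.mul_mem_mul (Finset.mul_mem_mul
      (Finset.inv_mem_inv hs') hl) hs)
  set K' : Set X := ⋃ γ ∈ Γ, (fun x => γ⁻¹ • x) '' K with hK'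
  have hK'c : IsCompact K' :=
    Γ.isCompact_biUnion fun γ _ => hK.image (continuous_const_smul _)
  obtain ⟨M, hM⟩ := hH LH K' hK'c
  refine ⟨T.finite_toSet.toFinset.card * M, fun 𝒱 h𝒱o h𝒱c => ?_⟩
  have hQ : IsCompact (⋃ l ∈ L, (fun x => l • x) '' K) :=
    L.isCompact_biUnion fun l _ => hK.image (continuous_const_smul _)
  have hP : IsCompact (⋃ h ∈ LH, (fun x => h • x) '' K') :=
    LH.isCompact_biUnion fun h _ => hK'c.image (continuous_const_smul (h : G))
  obtain ⟨N, 𝒱', hNo, hQN, h𝒱'f, h𝒱'o, hP𝒱', hstar⟩ :=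
    exists_star_refinement hQ hP h𝒱o (fun z hz => by
      obtain ⟨l, hl, x, hx, rfl⟩ := mem_iUnion₂.1 hz
      exact h𝒱c l hl x hx) T.finite_toSet
  obtain ⟨𝒰, f, hf⟩ := hM 𝒱' h𝒱'f h𝒱'o fun h hh x hx =>
    hP𝒱' (mem_iUnion₂.2 ⟨h, hh, x, hx, rfl⟩)
  refine ⟨labelPullback T D N '' 𝒰, ?_, ?_, encard_labelPullback_le hdisj N hf.mult_le, ?_, ?_⟩
  · rintro _ ⟨U, hU, rfl⟩
    exact isOpen_labelPullback hDo hNo (hf.isOpen U hU)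
  · rintro _ ⟨U, hU, rfl⟩
    exact exists_isSelection_labelPullback T.finite_toSet hDo hdisj htrans hstar (hf.isSelection hU)
  · rintro _ ⟨U, hU, rfl⟩ z ⟨-, s, -, hz, -⟩
    exact ⟨s, hDW s z hz⟩
  · intro γ hγ x hx hγW
    obtain ⟨U, hU, hxU⟩ := hf.long (γ⁻¹ • x) (mem_iUnion₂.2 ⟨γ, hγ, x, hx, rfl⟩)
    refine ⟨_, ⟨U, hU, rfl⟩, fun l hl => ?_⟩
    have hA : l * γ ∈ L * Γ := Finset.mul_mem_mul hl hγ
    have hT : t (l * γ) ∈ T := Finset.mem_image_of_mem t hA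
    have hh : (t (l * γ))⁻¹ * (l * γ) ∈ H := QuotientGroup.eq.1 (ht_mk (l * γ))
    refine ⟨hQN (mem_iUnion₂.2 ⟨l, hl, x, hx, rfl⟩), t (l * γ), hT, fun k hk => ?_, ?_⟩
    · have := hinv _ hh _ (hγW (k * l) (Finset.mul_mem_mul hk hl))
      simpa [diag, mul_smul, mul_assoc] using this
    · have := hxU ⟨_, hh⟩ (by
        rw [hLH, Finset.mem_preimage]
        exact Finset.mem_union_right _ (Finset.mul_mem_mul (Finset.inv_mem_inv hT) hA))
      simpa [Subgroup.smul_def, mul_smul] using this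

/-! ### Assembly over the orbits -/

theorem diag_mem_of_mem_setStab {G X : Type*} [Group G] [MulAction G X] {W : Set (G × X)} {g : G}
    (hg : g ∈ setStab G X W) {p : G × X} (hp : p ∈ W) : diag G X g p ∈ W := by
  have : diagSet G X g W = W := hg
  rw [← this]
  exact ⟨p, hp, rfl⟩

/-- Two subsets of `G × X` are equivalent if the diagonal action moves one to the other. -/
def diagSetoid (G X : Type*) [Group G] [MulAction G X] : Setoid (Set (G × X)) where
  r W W' := ∃ g : G, diagSet G X g W = W'
  iseqv :=
    { refl := fun W => ⟨1, diagSet_one G X W⟩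
      symm := by
        rintro W _ ⟨g, rfl⟩
        exact ⟨g⁻¹, by rw [← diagSet_mul, inv_mul_cancel, diagSet_one]⟩
      trans := by
        rintro W _ _ ⟨g, rfl⟩ ⟨h, rfl⟩
        exact ⟨h * g, diagSet_mul G X h g W⟩ }

open scoped Pointwise in
open scoped Classical in
theorem EqAsdimLE.ltcDimLE {G X : Type*} [Group G] [TopologicalSpace G]
    [DiscreteTopology G] [TopologicalSpace X] [CompletelyRegularSpace X] [MulAction G X]
    [ContinuousConstSMul G X] {F : Set (Subgroup G)} {d e n : ℕ} (hF : EqAsdimLE G X F d)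
    (hH : ∀ H ∈ F, LTCDimLE H X e) (hn : n + 1 = (d + 1) * (e + 1)) : LTCDimLE G X n := by
  intro L K hK
  -- Products `k * l` are needed because each `l • x` must itself satisfy the condition defining
  -- `D`, which looks one further step `k ∈ insert 1 L` ahead.
  obtain ⟨𝒲, h𝒲o, h𝒲long, h𝒲mult, h𝒲inv, h𝒲F⟩ := hF (insert 1 L * L) K hK
  -- finitely many members of `𝒲` suffice
  choose! Wx hWx hWxL using h𝒲long
  have hnhds : ∀ x ∈ K, {x' | ∀ l ∈ insert 1 L * L, (l, x') ∈ Wx x} ∈ 𝓝 x := by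
    intro x hx
    refine (Filter.eventually_all_finset _).2 fun l hl => ?_
    exact (Continuous.prodMk_right l).continuousAt
      ((h𝒲o _ (hWx x hx)).mem_nhds (hWxL x hx l hl))
  obtain ⟨I, hIK, hI⟩ := hK.elim_nhds_subcover _ hnhds
  -- orbit representatives
  let ρ : Set (G × X) → Set (G × X) := fun W => (Quotient.mk (diagSetoid G X) W).out
  have hρ : ∀ W, ∃ g : G, diagSet G X g (ρ W) = W := fun W =>
    Quotient.mk_out (s := diagSetoid G X) W
  choose γ hγ using hρ
  have hρeq : ∀ W g, ρ (diagSet G X g W) = ρ W := fun W g => by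
    have : Quotient.mk (diagSetoid G X) (diagSet G X g W) = Quotient.mk (diagSetoid G X) W :=
      Quotient.sound ((diagSetoid G X).symm ⟨g, rfl⟩)
    simp only [ρ, this]
  have hρρ : ∀ W, ρ (ρ W) = ρ W := fun W => by
    rw [← hρeq (ρ W) (γ W), hγ W]
  have hρ𝒲 : ∀ W ∈ 𝒲, ρ W ∈ 𝒲 := fun W hW => by
    have h1 := (h𝒲inv W hW (γ W)⁻¹).1
    have h2 : diagSet G X (γ W)⁻¹ W = ρ W := by
      nth_rw 2 [← hγ W]
      rw [← diagSet_mul, inv_mul_cancel, diagSet_one]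
    rwa [h2] at h1
  let R : Finset (Set (G × X)) := I.image fun x => ρ (Wx x)
  let Γ : Finset G := I.image fun x => γ (Wx x)
  have hR𝒲 : ∀ W ∈ R, W ∈ 𝒲 := by
    intro W hW
    obtain ⟨x, hx, rfl⟩ := Finset.mem_image.1 hW
    exact hρ𝒲 _ (hWx x (hIK x hx))
  have hRρ : ∀ W ∈ R, ρ W = W := by
    intro W hW
    obtain ⟨x, hx, rfl⟩ := Finset.mem_image.1 hW
    exact hρρ _
  have hcore := fun W (hW : W ∈ R) => (hH _ (h𝒲F W (hR𝒲 W hW))).exists_selections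
    (h𝒲o W (hR𝒲 W hW)) (fun g hg p hp => diag_mem_of_mem_setStab hg hp)
    (fun g p hp hgp => ((h𝒲inv W (hR𝒲 W hW) g).2).resolve_right fun hd =>
      disjoint_left.1 hd ⟨p, hp, rfl⟩ hgp) L Γ hK
  choose! M hM using hcore
  refine ⟨R.sup M, fun 𝒱 _ h𝒱o h𝒱c => ?_⟩
  choose! 𝒰 h𝒰o h𝒰s h𝒰m h𝒰W h𝒰l using fun W (hW : W ∈ R) => hM W hW 𝒱 h𝒱o h𝒱c
  refine ⟨⋃ W ∈ R, 𝒰 W, exists_isLongThinCover ?_ ?_ ?_ ?_⟩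
  · intro U hU
    obtain ⟨W, hW, hU⟩ := mem_iUnion₂.1 hU
    exact h𝒰o W hW U hU
  · intro x hx
    obtain ⟨i, hi, hxi⟩ := mem_iUnion₂.1 (hI hx)
    have hiR : ρ (Wx i) ∈ R := Finset.mem_image_of_mem (fun x => ρ (Wx x)) hi
    have hiΓ : γ (Wx i) ∈ Γ := Finset.mem_image_of_mem (fun x => γ (Wx x)) hi
    obtain ⟨U, hU, hUx⟩ := h𝒰l _ hiR _ hiΓ x hx fun l hl => by
      have h1 : (l, x) ∈ Wx i := hxi l hl
      rw [← hγ (Wx i)] at h1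
      obtain ⟨⟨a, b⟩, hab, h2⟩ := h1
      obtain ⟨rfl, rfl⟩ := Prod.mk_inj.1 h2
      simpa using hab
    exact ⟨U, mem_iUnion₂.2 ⟨_, hiR, hU⟩, hUx⟩
  · refine iSup_le fun z => ?_
    let Rz : Finset (Set (G × X)) := R.filter fun W => ∃ g : G, (g, g⁻¹ • z) ∈ W
    have hsub : {U | U ∈ ⋃ W ∈ R, 𝒰 W ∧ z ∈ U} ⊆ ⋃ W ∈ Rz, {U | U ∈ 𝒰 W ∧ z ∈ U} := by
      rintro U ⟨hU, hzU⟩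
      obtain ⟨W, hW, hU⟩ := mem_iUnion₂.1 hU
      exact mem_iUnion₂.2 ⟨W, Finset.mem_filter.2 ⟨hW, h𝒰W W hW U hU z hzU⟩, hU, hzU⟩
    have hRz : (Rz.card : ℕ∞) ≤ d + 1 := by
      have hg : ∀ W ∈ Rz, ∃ g : G, (g, g⁻¹ • z) ∈ W := fun W hW => (Finset.mem_filter.1 hW).2
      choose! g hg using hg
      -- Translating by `g W` takes `(g W, (g W)⁻¹ • z)` to `(1, z)`; representatives of different
      -- orbits have different translates, so the multiplicity of `𝒲` at `(1, z)` bounds their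
      -- number.
      have hinj : InjOn (fun W => diagSet G X (g W) W) (Rz : Set (Set (G × X))) := by
        intro W hW W' hW' h
        have h : diagSet G X (g W) W = diagSet G X (g W') W' := h
        rw [← hRρ W (Finset.mem_filter.1 hW).1, ← hRρ W' (Finset.mem_filter.1 hW').1,
          ← hρeq W (g W), h, hρeq]
      rw [← encard_coe_eq_coe_finsetCard]
      refine (encard_le_encard_of_injOn (t := {W | W ∈ 𝒲 ∧ ((1 : G), z) ∈ W}) ?_ hinj).trans
        ((le_iSup _ ((1 : G), z)).trans h𝒲mult)
      intro W hW
      refine ⟨(h𝒲inv W (hR𝒲 W (Finset.mem_filter.1 hW).1) _).1, _, hg W hW, ?_⟩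
      simp [diag]
    calc {U | U ∈ ⋃ W ∈ R, 𝒰 W ∧ z ∈ U}.encard
        ≤ ∑ W ∈ Rz, {U | U ∈ 𝒰 W ∧ z ∈ U}.encard :=
          (encard_le_encard hsub).trans (Rz.set_encard_biUnion_le _)
      _ ≤ Rz.card • ((e : ℕ∞) + 1) :=
          Finset.sum_le_card_nsmul _ _ _ fun W hW => h𝒰m W (Finset.mem_filter.1 hW).1 z
      _ ≤ ((d : ℕ∞) + 1) * (e + 1) := by
          rw [nsmul_eq_mul]
          gcongr
      _ = n + 1 := by exact_mod_cast hn.symm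
  · intro U hU
    obtain ⟨W, hW, hU⟩ := mem_iUnion₂.1 hU
    obtain ⟨f, hf⟩ := h𝒰s W hW U hU
    exact ⟨f, hf.mono (Finset.le_sup hW)⟩

/-! ### Passage to extended natural numbers -/

theorem exists_le_of_iInf_le {P : ℕ → Prop} {e : ℕ} (h : ⨅ (d : ℕ) (_ : P d), (d : ℕ∞) ≤ e) :
    ∃ d ≤ e, P d := by
  by_contra! hc
  have h1 : ((e + 1 : ℕ) : ℕ∞) ≤ ⨅ (d : ℕ) (_ : P d), (d : ℕ∞) := by
    refine le_iInf₂ fun d hd => ?_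
    by_contra hlt
    exact hc d (by have : d < e + 1 := by exact_mod_cast not_le.1 hlt
                   omega) hd
  have h2 : e + 1 ≤ e := by exact_mod_cast h1.trans h
  omega

theorem LTCDimLE.mono {G X : Type*} [Group G] [TopologicalSpace X] [MulAction G X] {d e : ℕ}
    (h : LTCDimLE G X d) (hde : d ≤ e) : LTCDimLE G X e := by
  intro L K hK
  obtain ⟨M, hM⟩ := h L K hK
  refine ⟨M, fun 𝒱 h𝒱f h𝒱o h𝒱c => ?_⟩
  obtain ⟨𝒰, f, hf⟩ := hM 𝒱 h𝒱f h𝒱o h𝒱c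
  exact ⟨𝒰, f, { hf with mult_le := hf.mult_le.trans (by gcongr) }⟩

end LongThin

theorem mainTheorem7 {G : Type*} {X : Type*} [Group G] [TopologicalSpace G] [DiscreteTopology G]
    [TopologicalSpace X] [T2Space X] [LocallyCompactSpace X]
    [MulAction G X] [ContinuousConstSMul G X]
    (F : Set (Subgroup G)) (hne : F.Nonempty)
    (hconj : ∀ H ∈ F, ∀ g : G, H.map (MulAut.conj g).toMonoidHom ∈ F)
    (hsub : ∀ H ∈ F, ∀ H' : Subgroup G, H' ≤ H → H' ∈ F) :
    LongThin.dimLTC G X + 1 ≤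
      (LongThin.eqasdim G X F + 1) * ⨆ H ∈ F, (LongThin.dimLTC H X + 1) := by
  have : CompletelyRegularSpace X :=
    (OnePoint.isOpenEmbedding_coe (X := X)).isInducing.completelyRegularSpace
  set s : ℕ∞ := ⨆ H ∈ F, (LongThin.dimLTC H X + 1) with hs
  have hle : ∀ H ∈ F, LongThin.dimLTC H X + 1 ≤ s := fun H hH =>
    le_iSup₂ (f := fun (H : Subgroup G) (_ : H ∈ F) => LongThin.dimLTC H X + 1) H hH
  -- Nonemptiness of `F` rules out the product `⊤ * 0 = 0`.
  have hs1 : 1 ≤ s := by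
    obtain ⟨H, hH⟩ := hne
    exact le_add_self.trans (hle H hH)
  have hs0 : s ≠ 0 := (zero_lt_one.trans_le hs1).ne'
  rcases eq_or_ne (LongThin.eqasdim G X F) ⊤ with hd | hd
  · simp [hd, ENat.top_mul hs0]
  rcases eq_or_ne s ⊤ with hst | hst
  · rw [hst, ENat.mul_top (by simp)]
    exact le_top
  obtain ⟨d, hd⟩ := ENat.ne_top_iff_exists.1 hd
  obtain ⟨m, hm⟩ := ENat.ne_top_iff_exists.1 hst
  obtain ⟨e, rfl⟩ : ∃ e, m = e + 1 := Nat.exists_eq_succ_of_ne_zero (by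
    rintro rfl
    exact hs0 (by simp [← hm]))
  obtain ⟨d', hd', hdF⟩ := LongThin.exists_le_of_iInf_le (P := LongThin.EqAsdimLE G X F) (e := d)
    hd.ge
  have hHe : ∀ H ∈ F, LongThin.LTCDimLE H X e := by
    intro H hH
    have h1 : LongThin.dimLTC H X ≤ e := by
      have h2 := hle H hH
      rw [← hm, Nat.cast_add, Nat.cast_one] at h2
      exact (ENat.add_le_add_iff_right (by simp)).1 h2
    obtain ⟨e', he', h⟩ := LongThin.exists_le_of_iInf_le h1
    exact h.mono he'
  have hpos : 0 < (d' + 1) * (e + 1) := by positivity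
  have hG := hdF.ltcDimLE hHe (n := (d' + 1) * (e + 1) - 1) (by omega)
  calc LongThin.dimLTC G X + 1 ≤ (((d' + 1) * (e + 1) - 1 : ℕ) : ℕ∞) + 1 := by
        gcongr
        exact iInf₂_le _ hG
    _ = (((d' + 1) * (e + 1) : ℕ) : ℕ∞) := by
        exact_mod_cast congrArg (Nat.cast (R := ℕ∞)) (Nat.sub_add_cancel hpos)
    _ ≤ (((d + 1) * (e + 1) : ℕ) : ℕ∞) := by
        exact_mod_cast Nat.mul_le_mul_right _ (Nat.succ_le_succ hd')
    _ = (LongThin.eqasdim G X F + 1) * s := by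
        rw [← hd, ← hm]
        push_cast
        rfl
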